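/- Let $A$ be a finite totally ordered set and let $k$ be a commutative unital ring. Let $\mathbf{Pl}_A$ be the plactic monoid on $A$, i.e. the quotient of the free monoid $A^*$ by the congruence generated by the Knuth relations $$xzy \sim zxy \quad (x \le y < z), \qquad yxz \sim yzx \quad (x < y \le z), \qquad x,y,z\in A.$$ Let $H^*(\mathbf{Pl}_A;k)=\bigoplus_{n\ge 0}H^n(\mathbf{Pl}_A;k)$ be the Hochschild cohomology of $\mathbf{Pl}_A$ with trivial coefficients: it is the cohomology of the complex with $HC^0=k$ and $$HC^n=\{f\colon \mathbf{Pl}_A^{\times n}\to k \mid f(x_1,\ldots,x_n)=0 \text{ whenever some } x_i=1\},$$ $$(df)(x_1,\ldots,x_{n+1})=f(x_2,\ldots,x_{n+1})+\sum_{i=1}^{n}(-1)^i f(x_1,\ldots,x_ix_{i+1},\ldots,x_{n+1})+(-1)^{n+1}f(x_1,\ldots,x_n),$$ made into an associative unital graded $k$-algebra by the cup product $$(f\smile g)(x_1,\ldots,x_{p+q})=f(x_1,\ldots,x_p)\,g(x_{p+1},\ldots,x_{p+q}),\qquad f\in HC^p,\ g\in HC^q.$$ For $a\in A$ let $\zeta_a\in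 H^1(\mathbf{Pl}_A;k)$ be the class of the $1$-cocycle sending $w\in\mathbf{Pl}_A$ to $m\cdot 1_k$, where $m$ is the number of occurrences of the letter $a$ in any word representing $w$. Then there is an injective homomorphism of unital $k$-algebras $$\Lambda(kA)\hookrightarrow H^*(\mathbf{Pl}_A;k)$$ from the exterior algebra of the free $k$-module $kA$ with basis $A$ that sends each $a\in A$ to $\zeta_a$. -/

import Mathlib

/-!
Plactic monoids, and the Hochschild cohomology algebra of a monoid with trivial coefficients.
-/

/-- The Knuth relations on words in a totally ordered alphabet:
`xzy ∼ zxy` for `x ≤ y < z`, and `yxz ∼ yzx` for `x < y ≤ z`. -/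
inductive KnuthRel (A : Type*) [LinearOrder A] : FreeMonoid A → FreeMonoid A → Prop
  | xzy (x y z : A) (hxy : x ≤ y) (hyz : y < z) :
      KnuthRel A (.of x * .of z * .of y) (.of z * .of x * .of y)
  | yxz (x y z : A) (hxy : x < y) (hyz : y ≤ z) :
      KnuthRel A (.of y * .of x * .of z) (.of y * .of z * .of x)

/-- The plactic monoid on `A`: the quotient of the free monoid on `A` by the congruence generated
by the Knuth relations. -/
abbrev Plactic (A : Type*) [LinearOrder A] : Type _ := PresentedMonoid (KnuthRel A)

/-- The number of occurrences of the letter `a` in an element of the plactic monoid. -/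
def Plactic.count {A : Type*} [LinearOrder A] (a : A) : Plactic A →* Multiplicative ℕ :=
  PresentedMonoid.lift (fun b => Multiplicative.ofAdd (if b = a then 1 else 0)) (by
    intro u v h
    cases h <;> simp only [map_mul, FreeMonoid.lift_eval_of] <;> ac_rfl)

/-- On the class of a word, `Plactic.count a` is the number of occurrences of `a` in the word. -/
theorem Plactic.count_mk {A : Type*} [LinearOrder A] (a : A) (w : FreeMonoid A) :
    (Plactic.count a (PresentedMonoid.mk (KnuthRel A) w)).toAdd = w.toList.count a := by
  have h : (Plactic.count a).comp (PresentedMonoid.mk (KnuthRel A)) = FreeMonoid.count a := by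
    refine FreeMonoid.hom_eq fun b => ?_
    change Multiplicative.ofAdd (if b = a then 1 else 0) = Multiplicative.ofAdd ([b].count a)
    rw [List.count_singleton]
    simp
  have := congrArg Multiplicative.toAdd (DFunLike.congr_fun h w)
  exact this

namespace MonoidHochschild

section Cochains

variable (k : Type*) [CommRing k] (M : Type*) [Monoid M]

/-- All functions `M ^ n → k`. -/
abbrev Fn (n : ℕ) : Type _ := (Fin n → M) → k

variable {M}

/-- The face maps `M ^ (n + 1) → M ^ n` for `0 ≤ j ≤ n + 1`, with entries numbered from `1`:
`face 0` drops the first entry, `face j` for `1 ≤ j ≤ n` replaces the entries `x_j, x_{j+1}` by the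
product `x_j * x_{j+1}`, and `face (n + 1)` drops the last entry. -/
def face {n : ℕ} (j : ℕ) (x : Fin (n + 1) → M) : Fin n → M := fun i =>
  if (i : ℕ) + 1 < j then x i.castSucc
  else if (i : ℕ) + 1 = j then x i.castSucc * x i.succ
  else x i.succ

theorem face_zero {n : ℕ} (x : Fin (n + 1) → M) : face 0 x = Fin.tail x := by
  ext i; simp [face, Fin.tail]

theorem face_castSucc_succ {n : ℕ} (j : Fin n) (x : Fin (n + 1) → M) :
    face ((j : ℕ) + 1) x = Fin.contractNth j.castSucc (· * ·) x := by
  ext i; simp [face, Fin.contractNth]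

theorem face_last {n : ℕ} (x : Fin (n + 1) → M) : face (n + 1) x = Fin.init x := by
  ext i; simp [face, Fin.init]

variable (M)

/-- The Hochschild differential with trivial coefficients,
`(d f)(x) = ∑_{j = 0}^{n + 1} (-1) ^ j f (face j x)`. -/
def d (n : ℕ) : Fn k M n →ₗ[k] Fn k M (n + 1) where
  toFun f x := ∑ j ∈ Finset.range (n + 2), (-1) ^ j * f (face j x)
  map_add' f g := by ext x; simp [mul_add, Finset.sum_add_distrib]
  map_smul' c f := by ext x; simp [Finset.mul_sum, mul_left_comm]

theorem d_apply (n : ℕ) (f : Fn k M n) (x : Fin (n + 1) → M) :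
    d k M n f x = ∑ j ∈ Finset.range (n + 2), (-1) ^ j * f (face j x) := rfl

/-- The differential in expanded form: `f(x_2, …, x_{n+1}) - f(x_1 x_2, …) + ⋯
+ (-1)^n f(…, x_n x_{n+1}) + (-1)^(n+1) f(x_1, …, x_n)`. -/
theorem d_apply_expanded (n : ℕ) (f : Fn k M n) (x : Fin (n + 1) → M) :
    d k M n f x = f (Fin.tail x)
      + ∑ j : Fin n, (-1) ^ ((j : ℕ) + 1) * f (Fin.contractNth j.castSucc (· * ·) x)
      + (-1) ^ (n + 1) * f (Fin.init x) := by
  rw [d_apply, Finset.sum_range_succ, Finset.sum_range_succ', ← Fin.sum_univ_eq_sum_range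
    (fun j => (-1 : k) ^ (j + 1) * f (face (j + 1) x))]
  simp only [face_zero, face_last, face_castSucc_succ]
  ring

/-- The module `HC^n` of Hochschild cochains: functions `f : M ^ n → k` that vanish as soon as one
argument is `1`. -/
def HC (n : ℕ) : Submodule k (Fn k M n) where
  carrier := {f | ∀ x, (∃ i, x i = 1) → f x = 0}
  add_mem' hf hg x hx := by simp [hf x hx, hg x hx]
  zero_mem' _ _ := rfl
  smul_mem' c f hf x hx := by simp [hf x hx]

/-- The differential preserves the Hochschild cochains. -/
theorem d_mem_HC {n : ℕ} {f : Fn k M n} (hf : f ∈ HC k M n) : d k M n f ∈ HC k M (n + 1) := by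
  rintro x ⟨i, hi⟩
  have hin := i.isLt
  rw [d_apply]
  have h1 : face (i : ℕ) x = face ((i : ℕ) + 1) x := by
    ext l
    rcases lt_trichotomy ((l : ℕ) + 1) i with h | h | h
    · simp [face, h, show (l : ℕ) < i by omega]
    · have : l.succ = i := Fin.ext (by simp [h])
      simp [face, h, this, hi]
    · rcases Nat.lt_or_ge (i : ℕ) l with h2 | h2
      · simp [face, show ¬ ((l : ℕ) + 1 < i) by omega, show (l : ℕ) + 1 ≠ i by omega,
          show ¬ ((l : ℕ) < i) by omega, show (l : ℕ) ≠ i by omega]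
      · have : l.castSucc = i := Fin.ext (by simp; omega)
        have h3 : (l : ℕ) = i := by omega
        simp [face, h3, this, hi]
  rw [Finset.sum_eq_add_of_mem (i : ℕ) ((i : ℕ) + 1) 
    (by rw [Finset.mem_range]; omega) (by rw [Finset.mem_range]; omega) (by simp), h1]
  · ring
  · rintro j hj ⟨hj1, hj2⟩
    have hj' : j < n + 2 := by simpa using hj
    rw [hf, mul_zero]
    rcases Nat.lt_or_ge j i with h | h
    · refine ⟨⟨(i : ℕ) - 1, by omega⟩, ?_⟩
      have : (⟨(i : ℕ) - 1, by omega⟩ : Fin n).succ = i := Fin.ext (by simp; omega)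
      simp only [face]
      rw [if_neg (by omega), if_neg (by omega), this, hi]
    · refine ⟨⟨i, by omega⟩, ?_⟩
      simp only [face]
      rw [if_pos (by omega)]
      exact hi

theorem face_face {n : ℕ} (i j : ℕ) (hij : i ≤ j) (x : Fin (n + 2) → M) :
    face i (face (j + 1) x) = face j (face i x) := by
  funext l
  simp only [face, Fin.val_castSucc, Fin.val_succ]
  split_ifs <;> first | omega | rfl | exact mul_assoc _ _ _ | exact (mul_assoc _ _ _).symm

/-- The differential squares to zero. -/
theorem d_d (n : ℕ) (f : Fn k M n) : d k M (n + 1) (d k M n f) = 0 := by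
  ext x
  simp only [d_apply, Finset.mul_sum, Pi.zero_apply]
  rw [← Finset.sum_product']
  refine Finset.sum_involution
    (fun p _ => if p.2 < p.1 then (p.2, p.1 - 1) else (p.2 + 1, p.1)) ?_ ?_ ?_ ?_
  · rintro ⟨j, i⟩ h
    dsimp only
    split_ifs with h1
    · obtain ⟨j, rfl⟩ : ∃ j', j = j' + 1 := ⟨j - 1, by omega⟩
      simp only [Nat.add_sub_cancel, face_face M i j (by omega) x]
      ring
    · simp only [face_face M j i (by omega) x]
      ring
  · rintro ⟨j, i⟩ h _
    dsimp only
    split_ifs with h1 <;> simp <;> omega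
  · rintro ⟨j, i⟩ h
    simp only [Finset.mem_product, Finset.mem_range] at h ⊢
    split_ifs with h1 <;> simp <;> omega
  · rintro ⟨j, i⟩ h
    dsimp only
    split_ifs with h1 h2 <;> simp <;> omega

/-- Hochschild `n`-cocycles. -/
def Z (n : ℕ) : Submodule k (Fn k M n) := HC k M n ⊓ LinearMap.ker (d k M n)

/-- Hochschild `n`-coboundaries. -/
def B : (n : ℕ) → Submodule k (Fn k M n)
  | 0 => ⊥
  | n + 1 => (HC k M n).map (d k M n)

/-- Coboundaries are cocycles. -/
theorem B_le_Z (n : ℕ) : B k M n ≤ Z k M n := by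
  cases n with
  | zero => exact bot_le
  | succ n =>
    rintro _ ⟨f, hf, rfl⟩
    exact ⟨d_mem_HC k M hf, LinearMap.mem_ker.2 (d_d k M n f)⟩

/-- The Hochschild cohomology `H^n(M; k)`: cocycles modulo coboundaries. -/
def H (n : ℕ) : Type _ := Z k M n ⧸ (B k M n).submoduleOf (Z k M n)

instance instAddCommGroupH (n : ℕ) : AddCommGroup (H k M n) :=
  inferInstanceAs (AddCommGroup (Z k M n ⧸ (B k M n).submoduleOf (Z k M n)))

instance instModuleH (n : ℕ) : Module k (H k M n) :=
  inferInstanceAs (Module k (Z k M n ⧸ (B k M n).submoduleOf (Z k M n)))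

/-- The cohomology class of a cocycle. -/
def cls {n : ℕ} : Z k M n →ₗ[k] H k M n := ((B k M n).submoduleOf (Z k M n)).mkQ

theorem cls_surjective {n : ℕ} : Function.Surjective (cls k M (n := n)) :=
  Submodule.mkQ_surjective _

theorem cls_eq_zero_iff {n : ℕ} (f : Z k M n) : cls k M f = 0 ↔ (f : Fn k M n) ∈ B k M n :=
  Submodule.Quotient.mk_eq_zero _

/-- The cup product of cochains, `(f ⌣ g)(x_1, …, x_{p+q}) =
f(x_1, …, x_p) g(x_{p+1}, …, x_{p+q})`. -/
def cup (p q : ℕ) : Fn k M p →ₗ[k] Fn k M q →ₗ[k] Fn k M (p + q) :=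
  LinearMap.mk₂ k
    (fun f g x => f (fun i => x (Fin.castAdd q i)) * g (fun i => x (Fin.natAdd p i)))
    (fun f f' g => by ext x; simp [add_mul])
    (fun c f g => by ext x; simp [mul_assoc])
    (fun f g g' => by ext x; simp [mul_add])
    (fun c f g => by ext x; simp [mul_left_comm])

theorem cup_mem_HC {p q : ℕ} {f : Fn k M p} {g : Fn k M q} (hf : f ∈ HC k M p)
    (hg : g ∈ HC k M q) : cup k M p q f g ∈ HC k M (p + q) := by
  rintro x ⟨i, hi⟩
  change f _ * g _ = 0
  induction i using Fin.addCases with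
  | left i => rw [hf _ ⟨i, hi⟩, zero_mul]
  | right i => rw [hg _ ⟨i, hi⟩, mul_zero]

/-- The differential is a derivation with respect to the cup product. -/
theorem d_cup {p q : ℕ} (f : Fn k M p) (g : Fn k M q) (x : Fin (p + q + 1) → M) :
    d k M (p + q) (cup k M p q f g) x
      = d k M p f (fun i => x ⟨i, by omega⟩) * g (fun i => x ⟨p + 1 + i, by omega⟩)
        + (-1) ^ p * (f (fun i => x ⟨i, by omega⟩)
            * d k M q g (fun i => x ⟨p + i, by omega⟩)) := by
  simp only [d_apply]
  change ∑ j ∈ Finset.range (p + q + 2), (-1) ^ j * (f (fun i => face j x (Fin.castAdd q i))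
    * g (fun i => face j x (Fin.natAdd p i))) = _
  have e1 : ∀ j ≤ p, (fun i : Fin q => face j x (Fin.natAdd p i))
      = fun i : Fin q => x ⟨p + 1 + i, by omega⟩ := by
    intro j hj
    ext i
    simp only [face, Fin.val_natAdd]
    rw [if_neg (by omega), if_neg (by omega)]
    congr 1
    apply Fin.ext
    simp; omega
  have e2 : ∀ j, (fun i : Fin p => face j x (Fin.castAdd q i))
      = face j (fun i : Fin (p + 1) => x ⟨i, by omega⟩) := by
    intro j; rfl
  have e3 : ∀ j, (fun i : Fin q => face (p + 1 + j) x (Fin.natAdd p i))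
      = face (j + 1) (fun i : Fin (q + 1) => x ⟨p + i, by omega⟩) := by
    intro j
    ext i
    have h1 : (p + (i : ℕ) + 1 < p + 1 + j) ↔ ((i : ℕ) + 1 < j + 1) := by omega
    have h2 : (p + (i : ℕ) + 1 = p + 1 + j) ↔ ((i : ℕ) + 1 = j + 1) := by omega
    simp only [face, Fin.val_natAdd, h1, h2]
    rfl
  have e4 : ∀ j, face (p + 1 + j) (fun i : Fin (p + 1) => x ⟨i, by omega⟩)
      = fun i : Fin p => x ⟨i, by omega⟩ := by
    intro j
    ext i
    simp only [face]
    rw [if_pos (by omega)]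
    rfl
  have e5 : face 0 (fun i : Fin (q + 1) => x ⟨p + i, by omega⟩)
      = fun i : Fin q => x ⟨p + 1 + i, by omega⟩ := by
    ext i
    simp only [face]
    rw [if_neg (by omega), if_neg (by omega)]
    congr 1
    apply Fin.ext
    simp; omega
  rw [show p + q + 2 = p + 1 + (q + 1) by ring, Finset.sum_range_add, Finset.sum_range_succ _ (p + 1),
    Finset.sum_range_succ' _ (q + 1)]
  have s1 : ∀ j ∈ Finset.range (p + 1), (-1 : k) ^ j *
      (f (fun i : Fin p => face j x (Fin.castAdd q i))
        * g (fun i : Fin q => face j x (Fin.natAdd p i)))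
      = (-1) ^ j * f (face j (fun i : Fin (p + 1) => x ⟨i, by omega⟩))
        * g (fun i => x ⟨p + 1 + i, by omega⟩) := by
    intro j hj
    rw [e1 j (by simp at hj; omega), e2, mul_assoc]
  rw [Finset.sum_congr rfl s1]
  simp only [e2, e3, e4, e5]
  have e4' := e4 0
  rw [add_zero] at e4'
  rw [e4', add_mul, mul_add, mul_add, Finset.sum_mul, Finset.mul_sum, Finset.mul_sum]
  have s2 : ∀ j ∈ Finset.range (q + 1), (-1 : k) ^ (p + 1 + j) *
      (f (fun i : Fin p => x ⟨i, by omega⟩)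
        * g (face (j + 1) (fun i : Fin (q + 1) => x ⟨p + i, by omega⟩)))
      = (-1) ^ p * (f (fun i : Fin p => x ⟨i, by omega⟩) * ((-1) ^ (j + 1)
        * g (face (j + 1) (fun i : Fin (q + 1) => x ⟨p + i, by omega⟩)))) := by
    intro j _; ring
  rw [Finset.sum_congr rfl s2]
  ring

theorem cup_mem_Z {p q : ℕ} {f : Fn k M p} {g : Fn k M q} (hf : f ∈ Z k M p)
    (hg : g ∈ Z k M q) : cup k M p q f g ∈ Z k M (p + q) := by
  refine ⟨cup_mem_HC k M hf.1 hg.1, LinearMap.mem_ker.2 ?_⟩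
  ext x
  rw [d_cup, LinearMap.mem_ker.1 hf.2, LinearMap.mem_ker.1 hg.2]
  simp

theorem B_cast {m n : ℕ} (h : m = n) {b : Fn k M m} (hb : b ∈ B k M m) :
    (fun x : Fin n → M => b (fun i => x (Fin.cast h i))) ∈ B k M n := by
  subst h
  exact hb

theorem cup_mem_B_left {p q : ℕ} {f : Fn k M p} {g : Fn k M q} (hf : f ∈ B k M p)
    (hg : g ∈ Z k M q) : cup k M p q f g ∈ B k M (p + q) := by
  cases p with
  | zero =>
    have : f = 0 := hf
    simp [this]
  | succ p =>
    obtain ⟨f', hf', rfl⟩ := hf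
    have h : p + q + 1 = p + 1 + q := by omega
    have h2 : d k M (p + q) (cup k M p q f' g) ∈ B k M (p + q + 1) :=
      ⟨_, cup_mem_HC k M hf' hg.1, rfl⟩
    convert B_cast k M h h2 using 1
    ext x
    rw [d_cup, LinearMap.mem_ker.1 hg.2]
    simp only [Pi.zero_apply, mul_zero, add_zero]
    rfl

theorem cup_mem_B_right {p q : ℕ} {f : Fn k M p} {g : Fn k M q} (hf : f ∈ Z k M p)
    (hg : g ∈ B k M q) : cup k M p q f g ∈ B k M (p + q) := by
  cases q with
  | zero =>
    have : g = 0 := hg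
    simp [this]
  | succ q =>
    obtain ⟨g', hg', rfl⟩ := hg
    refine ⟨(-1 : k) ^ p • cup k M p q f g',
      Submodule.smul_mem _ _ (cup_mem_HC k M hf.1 hg'), ?_⟩
    ext x
    rw [map_smul, Pi.smul_apply]
    refine (congrArg _ (d_cup k M (f : Fn k M p) g' x)).trans ?_
    rw [LinearMap.mem_ker.1 hf.2]
    simp only [Pi.zero_apply, zero_mul, zero_add, smul_eq_mul]
    rw [← mul_assoc, ← mul_pow]
    simp only [mul_neg, mul_one, neg_neg, one_pow, one_mul]
    rfl

/-- The cup product of cocycles. -/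
def cupZ (p q : ℕ) : Z k M p →ₗ[k] Z k M q →ₗ[k] Z k M (p + q) :=
  LinearMap.mk₂ k
    (fun f g => ⟨cup k M p q f g, cup_mem_Z k M f.2 g.2⟩)
    (fun f f' g => by ext1; simp)
    (fun c f g => by ext1; simp)
    (fun f g g' => by ext1; simp)
    (fun c f g => by ext1; simp)

/-- The cup product of cohomology classes, induced by the cup product of cocycles. -/
def cupH (p q : ℕ) : H k M p →ₗ[k] H k M q →ₗ[k] H k M (p + q) :=
  (Submodule.liftQ ((B k M q).submoduleOf (Z k M q))
    (Submodule.liftQ ((B k M p).submoduleOf (Z k M p)) ((cupZ k M p q).compr₂ (cls k M)) (by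
      intro f hf
      ext g
      exact (cls_eq_zero_iff k M _).2 (cup_mem_B_left k M hf g.2))).flip (by
    intro g hg
    ext f
    exact (cls_eq_zero_iff k M _).2 (cup_mem_B_right k M f.2 hg))).flip

theorem cupH_cls {p q : ℕ} (f : Z k M p) (g : Z k M q) :
    cupH k M p q (cls k M f) (cls k M g) = cls k M (cupZ k M p q f g) := rfl

/-- Every constant `c : k = HC^0` is a cocycle. -/
def constZ : k →ₗ[k] Z k M 0 where
  toFun c := ⟨fun _ => c, ⟨fun _ ⟨i, _⟩ => i.elim0, LinearMap.mem_ker.2 <| by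
    ext x; simp [d_apply, Finset.sum_range_succ]⟩⟩
  map_add' _ _ := rfl
  map_smul' _ _ := rfl

theorem mk_cls_eq {m n : ℕ} (h : m = n) (f : Z k M m) (g : Z k M n)
    (hfg : ∀ x : Fin n → M, (f : Fn k M m) (fun i => x (Fin.cast h i)) = (g : Fn k M n) x) :
    (GradedMonoid.mk m (cls k M f) : GradedMonoid (H k M)) = GradedMonoid.mk n (cls k M g) := by
  subst h
  have : f = g := Subtype.ext (funext hfg)
  rw [this]

end Cochains

section Algebra

variable (k : Type*) [CommRing k] (M : Type*) [Monoid M]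

instance instGMul : GradedMonoid.GMul (H k M) where
  mul {p q} a b := cupH k M p q a b

instance instGOne : GradedMonoid.GOne (H k M) where
  one := cls k M (constZ k M 1)

theorem gmk_mul {p q : ℕ} (f : Z k M p) (g : Z k M q) :
    (GradedMonoid.mk p (cls k M f) : GradedMonoid (H k M)) * GradedMonoid.mk q (cls k M g)
      = GradedMonoid.mk (p + q) (cls k M (cupZ k M p q f g)) := rfl

/-- The cup product makes `(H^n(M; k))_n` a graded ring. -/
instance instGRing : DirectSum.GRing (H k M) where
  mul_zero _ := map_zero _
  zero_mul b := by
    change cupH k M _ _ 0 b = 0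
    simp
  mul_add _ _ _ := map_add _ _ _
  add_mul a b c := by
    change cupH k M _ _ (a + b) c = cupH k M _ _ a c + cupH k M _ _ b c
    simp
  one_mul := by
    rintro ⟨n, a⟩
    obtain ⟨f, rfl⟩ := cls_surjective k M a
    refine mk_cls_eq k M (zero_add n) (cupZ k M 0 n (constZ k M 1) f) f fun x => ?_
    change (1 : k) * (f : Fn k M n) _ = _
    rw [one_mul]
    refine congrArg (f : Fn k M n) (funext fun i => congrArg x (Fin.ext ?_))
    simp
  mul_one := by
    rintro ⟨n, a⟩
    obtain ⟨f, rfl⟩ := cls_surjective k M a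
    refine mk_cls_eq k M (add_zero n) (cupZ k M n 0 f (constZ k M 1)) f fun x => ?_
    change (f : Fn k M n) _ * (1 : k) = _
    rw [mul_one]
    congr 1
  mul_assoc := by
    rintro ⟨p, a⟩ ⟨q, b⟩ ⟨r, c⟩
    obtain ⟨f, rfl⟩ := cls_surjective k M a
    obtain ⟨g, rfl⟩ := cls_surjective k M b
    obtain ⟨h, rfl⟩ := cls_surjective k M c
    refine mk_cls_eq k M (add_assoc p q r) (cupZ k M (p + q) r (cupZ k M p q f g) h)
      (cupZ k M p (q + r) f (cupZ k M q r g h)) fun x => ?_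
    change (f : Fn k M p) _ * (g : Fn k M q) _ * (h : Fn k M r) _
      = (f : Fn k M p) _ * ((g : Fn k M q) _ * (h : Fn k M r) _)
    rw [mul_assoc]
    refine congrArg _ (congrArg _ (congrArg (h : Fn k M r)
      (funext fun i => congrArg x (Fin.ext ?_))))
    simp [add_assoc]
  natCast n := cls k M (constZ k M n)
  natCast_zero := by simp
  natCast_succ n := by
    change _ = cls k M (constZ k M n) + cls k M (constZ k M 1)
    simp
  intCast n := cls k M (constZ k M n)
  intCast_ofNat n := by simp
  intCast_negSucc_ofNat n := by
    rw [← map_neg, ← map_neg, Int.cast_negSucc]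

/-- The cup product makes `(H^n(M; k))_n` a graded `k`-algebra, with `k` acting through the constant
cochains of degree `0`. -/
instance instGAlgebra : DirectSum.GAlgebra k (H k M) where
  toFun := ((cls k M).comp (constZ k M)).toAddMonoidHom
  map_one := rfl
  map_mul r s := rfl
  commutes := by
    rintro r ⟨n, a⟩
    obtain ⟨f, rfl⟩ := cls_surjective k M a
    refine mk_cls_eq k M (by omega) (cupZ k M 0 n (constZ k M r) f)
      (cupZ k M n 0 f (constZ k M r)) fun x => ?_
    change r * (f : Fn k M n) _ = (f : Fn k M n) _ * r
    rw [mul_comm]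
    refine congrArg (· * r) (congrArg (f : Fn k M n) (funext fun i => congrArg x (Fin.ext ?_)))
    simp
  smul_def := by
    rintro r ⟨n, a⟩
    obtain ⟨f, rfl⟩ := cls_surjective k M a
    refine (mk_cls_eq k M (by omega) (cupZ k M 0 n (constZ k M r) f) (r • f) fun x => ?_).symm
    change r * (f : Fn k M n) _ = r * (f : Fn k M n) _
    refine congrArg _ (congrArg (f : Fn k M n) (funext fun i => congrArg x (Fin.ext ?_)))
    simp

/-- The Hochschild cohomology algebra `H^*(M; k) = ⨁ n, H^n(M; k)` of the monoid `M` with trivial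
coefficients, with the cup product. -/
abbrev Cohomology : Type _ := DirectSum ℕ (H k M)

/-- The class of a cocycle of degree `n` in the cohomology algebra. -/
def toCohomology {n : ℕ} : Z k M n →ₗ[k] Cohomology k M :=
  (DirectSum.lof k ℕ (H k M) n).comp (cls k M)

end Algebra

end MonoidHochschild

open MonoidHochschild in
/-- The letter-counting `1`-cocycle `ζ_a` of the plactic monoid: it sends `w` to the number of
occurrences of `a` in `w`, taken in `k`. -/
def Plactic.zeta (k : Type*) [CommRing k] {A : Type*} [LinearOrder A] (a : A) :
    Z k (Plactic A) 1 :=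
  ⟨fun w => (((Plactic.count a (w 0)).toAdd : ℕ) : k), by
    refine ⟨?_, LinearMap.mem_ker.2 ?_⟩
    · rintro x ⟨i, hi⟩
      rw [Subsingleton.elim i 0] at hi
      simp [hi]
    · ext x
      simp [d_apply, Finset.sum_range_succ, face]⟩

/-! The classes `ζ_a` generate an exterior algebra because squares of their linear combinations
vanish and because commuting elements of the monoid detect all their products.

Squares: the function `w ↦ choose (count a w) 2` bounds `ζ_a ⌣ ζ_a` up to sign, over any `k`, even
when `2` is not invertible. Such primitives extend to linear combinations, so the universal property
of the exterior algebra gives the homomorphism.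

Injectivity: the strictly decreasing words `column a` on the letters `≤ a` commute pairwise
(`commute_column`). Antisymmetrized evaluation at commuting elements kills coboundaries
(`antisymmEval_d`), hence is defined on cohomology; on a product of `1`-cocycles it is the
determinant of their values (`antisymmEval_cupTuple`). The values of the `ζ_a` at the columns form a
unitriangular matrix, so evaluation at columns is a coordinate system on `kA`, and these
determinants are the coordinates on its exterior algebra. Each coordinate thus factors through the
homomorphism. -/

/-! ### Commuting columns in the plactic monoid. -/

namespace Plactic

variable {A : Type*} [LinearOrder A]

/-- The class of a word in the plactic monoid. -/
def ofWord (L : List A) : Plactic A := PresentedMonoid.mk (KnuthRel A) (FreeMonoid.ofList L)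

theorem ofWord_append (L L' : List A) : ofWord (L ++ L') = ofWord L * ofWord L' :=
  map_mul (PresentedMonoid.mk (KnuthRel A)) _ _

theorem ofWord_cons (x : A) (L : List A) : ofWord (x :: L) = ofWord [x] * ofWord L :=
  ofWord_append [x] L

theorem ofWord_eq_of_knuthRel {u v : FreeMonoid A} (h : KnuthRel A u v) (L : List A) :
    ofWord (u.toList ++ L) = ofWord (v.toList ++ L) := by
  rw [ofWord_append, ofWord_append]
  exact congrArg (· * _) (Quotient.sound (ConGen.Rel.of _ _ h))

theorem ofWord_knuth_xzy {x y z : A} (hxy : x ≤ y) (hyz : y < z) (L : List A) :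
    ofWord (x :: z :: y :: L) = ofWord (z :: x :: y :: L) :=
  ofWord_eq_of_knuthRel (.xzy x y z hxy hyz) L

theorem ofWord_knuth_yxz {x y z : A} (hxy : x < y) (hyz : y ≤ z) (L : List A) :
    ofWord (y :: x :: z :: L) = ofWord (y :: z :: x :: L) :=
  ofWord_eq_of_knuthRel (.yxz x y z hxy hyz) L

/-- A letter moves from the left through larger letters of a column to its own copy. -/
theorem ofWord_cons_append_self {x : A} {L : List A} (hL : (L ++ [x]).Pairwise (· > ·))
    (R : List A) : ofWord (x :: (L ++ x :: R)) = ofWord (L ++ x :: x :: R) := by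
  induction L with
  | nil => rfl
  | cons z L ih =>
    simp only [List.cons_append, List.pairwise_cons] at hL
    -- To pass `z`, the letter `x` needs a following letter `y` with `x ≤ y < z`: it is the next
    -- letter of the column, possibly the final copy of `x` itself.
    have key : ofWord (x :: z :: (L ++ x :: R)) = ofWord (z :: x :: (L ++ x :: R)) := by
      cases L with
      | nil => exact ofWord_knuth_xzy le_rfl (hL.1 x (by simp)) R
      | cons y L =>
        refine ofWord_knuth_xzy ?_ (hL.1 y (by simp)) _
        have := hL.2
        simp only [List.cons_append, List.pairwise_cons] at this
        exact (this.1 x (by simp)).le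
    rw [List.cons_append, List.cons_append, key, ofWord_cons, ih hL.2, ← ofWord_cons]

/-- A letter moves to the right through a column of letters that are at most as large. -/
theorem ofWord_cons_cons_append {x y : A} {L : List A} (hL : (y :: L).Pairwise (· > ·))
    (hyx : y ≤ x) : ofWord (y :: x :: L) = ofWord (y :: (L ++ [x])) := by
  induction L generalizing y with
  | nil => rfl
  | cons w L ih =>
    obtain ⟨h1, h2⟩ := List.pairwise_cons.1 hL
    have hwy : w < y := h1 w (by simp)
    -- The head `y` lets `x` pass `w`; then `w ≤ x` takes over the role of the head.
    rw [← ofWord_knuth_yxz hwy hyx, ofWord_cons, ih h2 (hwy.le.trans hyx), ← ofWord_cons]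
    rfl

/-- A column commutes with each of its letters. -/
theorem commute_letter_column {x : A} {L : List A} (hL : L.Pairwise (· > ·)) (hx : x ∈ L) :
    Commute (ofWord [x]) (ofWord L) := by
  obtain ⟨L₁, L₂, rfl⟩ := List.append_of_mem hx
  change _ * _ = _ * _
  -- In words: `x L₁ x L₂ = L₁ x x L₂ = L₁ x L₂ x`.
  rw [← ofWord_append, ← ofWord_append, List.singleton_append, ofWord_cons_append_self,
    ofWord_append, ofWord_cons_cons_append (List.pairwise_append.1 hL).2.1 le_rfl,
    ← ofWord_append, List.append_assoc]
  · rfl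
  · rw [← List.singleton_append, ← List.append_assoc] at hL
    exact (List.pairwise_append.1 hL).1

/-- A column commutes with each word in its letters. -/
theorem commute_word_column {L L' : List A} (hL : L.Pairwise (· > ·)) (h : L' ⊆ L) :
    Commute (ofWord L') (ofWord L) := by
  induction L' with
  | nil => exact Commute.one_left _
  | cons x L' ih =>
    rw [ofWord_cons]
    exact (commute_letter_column hL (h (by simp))).mul_left
      (ih fun y hy => h (List.mem_cons_of_mem _ hy))

section Column

variable [Fintype A]

/-- The column of all letters that are at most `a`. -/
def column (a : A) : Plactic A := ofWord ((Finset.univ.filter (· ≤ a)).sort (· ≥ ·))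

/-- Of two columns, one is a word in the letters of the other. -/
theorem commute_column (a b : A) : Commute (column a) (column b) := by
  wlog h : a ≤ b generalizing a b
  · exact (this b a (le_of_not_ge h)).symm
  refine commute_word_column ?_ fun x hx => ?_
  · exact Finset.sortedGT_sort _ |>.pairwise
  · simp only [Finset.mem_sort, Finset.mem_filter, Finset.mem_univ, true_and] at hx ⊢
    exact hx.trans h

theorem count_column (a b : A) : (count a (column b)).toAdd = if a ≤ b then 1 else 0 := by
  rw [column, ofWord, count_mk, FreeMonoid.toList_ofList,
    List.Nodup.count (Finset.sort_nodup _ _)]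
  simp

end Column

end Plactic

/-! ### Antisymmetrized evaluation at commuting elements. -/

namespace MonoidHochschild

section Antisymm

variable (k : Type*) [CommRing k] {M : Type*}

/-- The antisymmetrized evaluation of cochains at a tuple of elements. -/
def antisymmEval {n : ℕ} (c : Fin n → M) : Fn k M n →ₗ[k] k :=
  ∑ σ : Equiv.Perm (Fin n), ((Equiv.Perm.sign σ : ℤ) : k) • LinearMap.proj (c ∘ σ)

theorem antisymmEval_apply {n : ℕ} (c : Fin n → M) (f : Fn k M n) :
    antisymmEval k c f = ∑ σ : Equiv.Perm (Fin n), ((Equiv.Perm.sign σ : ℤ) : k) * f (c ∘ σ) := by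
  simp [antisymmEval]

variable [Monoid M]

theorem face_comp_swap {n : ℕ} (j : Fin n) (x : Fin (n + 1) → M)
    (h : Commute (x j.castSucc) (x j.succ)) :
    face ((j : ℕ) + 1) (x ∘ Equiv.swap j.castSucc j.succ) = face ((j : ℕ) + 1) x := by
  have hne (i : Fin (n + 1)) (h1 : (i : ℕ) ≠ j) (h2 : (i : ℕ) ≠ j + 1) :
      Equiv.swap j.castSucc j.succ i = i :=
    Equiv.swap_apply_of_ne_of_ne (fun h => h1 (by simp [h])) (fun h => h2 (by simp [h]))
  ext i
  simp only [face, Function.comp_apply, add_left_inj]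
  split_ifs with h1 h2
  · rw [hne _ (by simp; omega) (by simp; omega)]
  · obtain rfl : i = j := Fin.ext h2
    simpa using h.eq.symm
  · rw [hne _ (by simp; omega) (by simp; omega)]

/-- The antisymmetrized evaluation at commuting elements vanishes on differentials. -/
theorem antisymmEval_d {n : ℕ} (c : Fin (n + 1) → M) (hc : ∀ i j, Commute (c i) (c j))
    (f : Fn k M n) : antisymmEval k c (d k M n f) = 0 := by
  have inner (j : Fin n) : ∑ σ : Equiv.Perm (Fin (n + 1)),
      ((Equiv.Perm.sign σ : ℤ) : k) * f (face ((j : ℕ) + 1) (c ∘ σ)) = 0 := by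
    have hne : j.castSucc ≠ j.succ := Fin.castSucc_lt_succ.ne
    -- Inner faces cancel in pairs: exchanging the two commuting factors keeps their product and
    -- flips the sign.
    refine Finset.sum_involution (fun σ _ => σ * Equiv.swap j.castSucc j.succ) ?_ ?_ ?_ ?_
    · intro σ _
      rw [Equiv.Perm.coe_mul, ← Function.comp_assoc, face_comp_swap j (c ∘ σ) (hc _ _)]
      simp [Equiv.Perm.sign_swap hne]
    · intro σ _ _ h
      exact hne (Equiv.swap_eq_one_iff.1 (mul_eq_left.1 h))
    · simp
    · simp [mul_assoc]
  have outer : ∑ σ : Equiv.Perm (Fin (n + 1)),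
        ((Equiv.Perm.sign σ : ℤ) : k) * f (face (n + 1) (c ∘ σ))
      = (-1) ^ n * ∑ σ : Equiv.Perm (Fin (n + 1)),
        ((Equiv.Perm.sign σ : ℤ) : k) * f (face 0 (c ∘ σ)) := by
    -- A cyclic rotation, of sign `(-1) ^ n`, turns the last face into the first.
    rw [← Equiv.sum_comp (Equiv.mulRight (finRotate (n + 1))), Finset.mul_sum]
    refine Finset.sum_congr rfl fun σ _ => ?_
    have : face (n + 1) (c ∘ (σ * finRotate (n + 1))) = face 0 (c ∘ σ) := by
      rw [face_last, face_zero]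
      ext i
      simp [Fin.init, Fin.tail]
    rw [Equiv.coe_mulRight, this]
    simp [sign_finRotate]
    ring
  simp only [antisymmEval_apply, d_apply, Finset.mul_sum]
  rw [Finset.sum_comm, Finset.sum_range_succ, Finset.sum_range_succ',
    ← Fin.sum_univ_eq_sum_range (fun j => ∑ σ : Equiv.Perm (Fin (n + 1)),
      ((Equiv.Perm.sign σ : ℤ) : k) * ((-1) ^ (j + 1) * f (face (j + 1) (c ∘ σ)))) n]
  have pull (j : ℕ) : ∑ σ : Equiv.Perm (Fin (n + 1)),
        ((Equiv.Perm.sign σ : ℤ) : k) * ((-1) ^ j * f (face j (c ∘ σ)))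
      = (-1) ^ j * ∑ σ : Equiv.Perm (Fin (n + 1)),
        ((Equiv.Perm.sign σ : ℤ) : k) * f (face j (c ∘ σ)) := by
    rw [Finset.mul_sum]
    exact Finset.sum_congr rfl fun σ _ => mul_left_comm _ _ _
  simp only [pull, inner, outer]
  -- The two outer faces cancel because their relative sign is `(-1) ^ (2 * n + 1)`.
  rw [← mul_assoc, ← pow_add, show n + 1 + n = 2 * n + 1 by ring, pow_succ, pow_mul]
  simp

/-- The antisymmetrized evaluation at commuting elements, as a functional on cohomology. -/
def antisymmEvalH {n : ℕ} (c : Fin n → M) (hc : ∀ i j, Commute (c i) (c j)) : H k M n →ₗ[k] k :=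
  Submodule.liftQ _ ((antisymmEval k c).comp (Z k M n).subtype) (by
    intro f hf
    cases n with
    | zero =>
      have : (f : Fn k M 0) = 0 := hf
      simp [this]
    | succ n =>
      obtain ⟨g, -, hg⟩ := hf
      refine LinearMap.mem_ker.2 ((congrArg _ hg.symm).trans (antisymmEval_d k c hc g)))

theorem antisymmEvalH_cls {n : ℕ} (c : Fin n → M) (hc : ∀ i j, Commute (c i) (c j))
    (f : Z k M n) : antisymmEvalH k c hc (cls k M f) = antisymmEval k c f := rfl

end Antisymm

/-! ### Cup products and squares of `1`-cocycles. -/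

variable {k : Type*} [CommRing k] {M : Type*} [Monoid M]

/-- The cup product of a tuple of `1`-cocycles. -/
def cupTuple : {n : ℕ} → (Fin n → Z k M 1) → Z k M n
  | 0, _ => constZ k M 1
  -- Splitting off the last factor gives degree `n + 1` definitionally, so no cast is needed.
  | n + 1, f => cupZ k M n 1 (cupTuple (Fin.init f)) (f (Fin.last n))

theorem cupTuple_apply {n : ℕ} (f : Fin n → Z k M 1) (x : Fin n → M) :
    (cupTuple f : Fn k M n) x = ∏ i, (f i : Fn k M 1) fun _ => x i := by
  induction n with
  | zero => simp [cupTuple, constZ]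
  | succ n ih =>
    rw [Fin.prod_univ_castSucc]
    change (cupTuple (Fin.init f) : Fn k M n) _ * (f (Fin.last n) : Fn k M 1) _ = _
    rw [ih]
    refine congrArg (_ * (f (Fin.last n) : Fn k M 1) ·) (funext fun i => congrArg x (Fin.ext ?_))
    simp

theorem prod_ofFn_toCohomology {n : ℕ} (f : Fin n → Z k M 1) :
    (List.ofFn fun i => toCohomology k M (f i)).prod = toCohomology k M (cupTuple f) := by
  induction n with
  | zero => rfl
  | succ n ih =>
    rw [List.ofFn_succ', List.prod_concat]
    refine (congrArg (· * _) (ih (Fin.init f))).trans ?_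
    exact DirectSum.of_mul_of _ _

theorem antisymmEval_cupTuple {n : ℕ} (c : Fin n → M) (f : Fin n → Z k M 1) :
    antisymmEval k c (cupTuple f)
      = (Matrix.of fun i j => (f i : Fn k M 1) fun _ => c j).det := by
  -- The Leibniz formula `Matrix.det_apply'` permutes row indices, whereas here the permutation acts
  -- on the elements, which index columns.
  rw [antisymmEval_apply, ← Matrix.det_transpose, Matrix.det_apply']
  simp [cupTuple_apply]

theorem coe_cocycle_mul (f : Z k M 1) (x y : M) : (f : Fn k M 1) (fun _ => x * y)
    = (f : Fn k M 1) (fun _ => x) + (f : Fn k M 1) fun _ => y := by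
  have h := congrFun (LinearMap.mem_ker.1 f.2.2) ![x, y]
  have e0 : face (n := 1) 0 ![x, y] = fun _ => y := by ext i; simp [face]
  have e1 : face (n := 1) 1 ![x, y] = fun _ => x * y := by
    ext i; simp [face, Subsingleton.elim i 0]
  have e2 : face (n := 1) 2 ![x, y] = fun _ => x := by
    ext i; simp [face, Subsingleton.elim i 0]
  simp only [d_apply, Finset.sum_range_succ, Finset.sum_range_zero, e0, e1, e2, Pi.zero_apply] at h
  linear_combination -h

/-- The `1`-cochain `-g` has the differential `f ⌣ f`. -/
def IsSquarePrimitive (f : Z k M 1) (g : M → k) : Prop := ∀ x y,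
  g (x * y) = g x + g y + (f : Fn k M 1) (fun _ => x) * (f : Fn k M 1) fun _ => y

namespace IsSquarePrimitive

theorem zero : IsSquarePrimitive (0 : Z k M 1) 0 := fun x y => by simp

/-- The pointwise product of `f` and `f'` accounts for the cross terms `f ⌣ f' + f' ⌣ f`, since both
are additive. -/
theorem add {f f' : Z k M 1} {g g' : M → k} (h : IsSquarePrimitive f g)
    (h' : IsSquarePrimitive f' g') : IsSquarePrimitive (f + f')
      fun x => g x + g' x + (f : Fn k M 1) (fun _ => x) * (f' : Fn k M 1) fun _ => x := by
  intro x y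
  simp only [h x y, h' x y, coe_cocycle_mul, Submodule.coe_add, Pi.add_apply]
  ring

theorem smul {f : Z k M 1} {g : M → k} (h : IsSquarePrimitive f g) (c : k) :
    IsSquarePrimitive (c • f) fun x => c ^ 2 * g x := by
  intro x y
  simp only [h x y, Submodule.coe_smul, Pi.smul_apply, smul_eq_mul]
  ring

theorem toCohomology_mul_self {f : Z k M 1} {g : M → k} (h : IsSquarePrimitive f g) :
    toCohomology k M f * toCohomology k M f = 0 := by
  -- The bounding cochain has to be normalized.
  have h1 : g 1 = 0 := by
    have h1 := h 1 1
    rw [f.2.1 (fun _ => 1) ⟨0, rfl⟩, mul_one] at h1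
    linear_combination -h1
  have : cls k M (cupZ k M 1 1 f f) = 0 := by
    refine (cls_eq_zero_iff k M _).2 ⟨fun x => -g (x 0), ?_, ?_⟩
    · rintro x ⟨i, hi⟩
      rw [Subsingleton.elim i 0] at hi
      simp [hi, h1]
    · ext x
      have e : (cupZ k M 1 1 f f : Fn k M 2) x
          = (f : Fn k M 1) (fun _ => x 0) * (f : Fn k M 1) fun _ => x 1 := by
        change (f : Fn k M 1) _ * (f : Fn k M 1) _ = _
        refine congrArg₂ (· * ·) (congrArg f.1 (funext fun i => ?_))
          (congrArg f.1 (funext fun i => ?_)) <;> rw [Subsingleton.elim i 0] <;> rfl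
      rw [e, d_apply]
      simp [Finset.sum_range_succ, face, h (x 0) (x 1)]
      ring
  refine (DirectSum.of_mul_of _ _).trans ?_
  exact (congrArg _ this).trans (map_zero _)

end IsSquarePrimitive

end MonoidHochschild

open MonoidHochschild

/-! ### The homomorphism from the exterior algebra. -/

namespace Plactic

variable {A : Type*} [LinearOrder A] (k : Type*) [CommRing k]

/-- The `1`-cocycle of a linear combination of letters. -/
noncomputable def linearZeta : (A →₀ k) →ₗ[k] Z k (Plactic A) 1 :=
  Finsupp.linearCombination k (zeta k)

theorem linearZeta_single (a : A) : linearZeta k (Finsupp.single a 1) = zeta k a := by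
  simp [linearZeta]

/-- This is Vandermonde's identity `choose (m + n) 2 = choose m 2 + choose n 2 + m * n`. -/
theorem isSquarePrimitive_zeta (a : A) :
    IsSquarePrimitive (zeta k a) fun x => (((count a x).toAdd.choose 2 : ℕ) : k) := by
  intro x y
  change (((count a (x * y)).toAdd.choose 2 : ℕ) : k)
    = (((count a x).toAdd.choose 2 : ℕ) : k) + (((count a y).toAdd.choose 2 : ℕ) : k)
      + (((count a x).toAdd : ℕ) : k) * (((count a y).toAdd : ℕ) : k)
  rw [map_mul, toAdd_mul]
  generalize (count a x).toAdd = m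
  generalize (count a y).toAdd = n
  rw [← Nat.cast_add, ← Nat.cast_mul, ← Nat.cast_add]
  congr 1
  induction n with
  | zero => simp
  | succ n ih =>
    rw [← add_assoc, Nat.choose_succ_succ' (m + n), ih, Nat.choose_succ_succ' n, Nat.choose_one_right,
      Nat.choose_one_right]
    ring

theorem exists_isSquarePrimitive (v : A →₀ k) : ∃ g, IsSquarePrimitive (linearZeta k v) g := by
  induction v using Finsupp.induction_linear with
  | zero => exact ⟨0, by simpa using IsSquarePrimitive.zero⟩
  | add v w hv hw =>
    obtain ⟨g, hg⟩ := hv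
    obtain ⟨g', hg'⟩ := hw
    exact ⟨_, by simpa using hg.add hg'⟩
  | single a c =>
    rw [linearZeta, Finsupp.linearCombination_single]
    exact ⟨_, (isSquarePrimitive_zeta k a).smul c⟩

/-- The homomorphism from the exterior algebra of the free module on the letters to the Hochschild
cohomology algebra of the plactic monoid. -/
noncomputable def exteriorToCohomology :
    ExteriorAlgebra k (A →₀ k) →ₐ[k] Cohomology k (Plactic A) :=
  ExteriorAlgebra.lift k ⟨(toCohomology k (Plactic A)).comp (linearZeta k), fun v =>
    (exists_isSquarePrimitive k v).choose_spec.toCohomology_mul_self⟩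

theorem exteriorToCohomology_ι (v : A →₀ k) : exteriorToCohomology k (ExteriorAlgebra.ι k v)
    = toCohomology k (Plactic A) (linearZeta k v) :=
  ExteriorAlgebra.lift_ι_apply k _ _ v

theorem exteriorToCohomology_ιMulti {n : ℕ} (v : Fin n → A →₀ k) :
    exteriorToCohomology k (ExteriorAlgebra.ιMulti k n v)
      = toCohomology k (Plactic A) (cupTuple fun i => linearZeta k (v i)) := by
  rw [ExteriorAlgebra.ιMulti_apply, map_list_prod, List.map_ofFn, ← prod_ofFn_toCohomology]
  congr 2
  ext1 i
  exact exteriorToCohomology_ι k (v i)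

/-! ### Injectivity by duality with columns. -/

variable [Fintype A]

/-- The matrix of the numbers of occurrences of the letters in the columns. -/
def columnMatrix : Matrix A A k := .of fun b a => if a ≤ b then 1 else 0

theorem det_columnMatrix : (columnMatrix k : Matrix A A k).det = 1 := by
  rw [Matrix.det_of_isLowerTriangular (columnMatrix k) fun i j h => if_neg (not_le_of_gt h)]
  simp [columnMatrix]

/-- The basis of the free module on the letters that is dual to the evaluations at columns. -/
noncomputable def columnBasis : Module.Basis A k (A →₀ k) :=
  .ofRepr (Matrix.toLinearEquiv Finsupp.basisSingleOne (columnMatrix k)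
    (by rw [det_columnMatrix]; exact isUnit_one))

/-- This identifies determinants of coordinates with determinants of values of cocycles at columns.
-/
theorem columnBasis_repr (v : A →₀ k) (a : A) :
    (columnBasis k).repr v a = (linearZeta k v : Fn k (Plactic A) 1) fun _ => column a := by
  change Matrix.toLin Finsupp.basisSingleOne Finsupp.basisSingleOne (columnMatrix k) v a = _
  induction v using Finsupp.induction_linear with
  | zero => simp
  | add v w hv hw => simp [hv, hw]
  | single b c =>
    rw [linearZeta, Finsupp.linearCombination_single]
    change _ = c * (((count b (column a)).toAdd : ℕ) : k)
    rw [count_column]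
    simp only [Matrix.toLin_apply, columnMatrix, Matrix.mulVec, dotProduct, Finsupp.single_apply,
      Finsupp.basisSingleOne_repr, Finsupp.coe_basisSingleOne, LinearEquiv.refl_apply,
      Matrix.of_apply, Finsupp.finsetSum_apply, Finsupp.smul_apply, smul_eq_mul]
    simp

theorem exteriorToCohomology_injective :
    Function.Injective (exteriorToCohomology k : _ →ₐ[k] Cohomology k (Plactic A)) := by
  let b := (columnBasis k : Module.Basis A k (A →₀ k))
  -- Every coordinate on the exterior algebra, in the basis induced by `b`, is a functional on
  -- cohomology composed with the homomorphism.
  have key (s : Finset A) : ∃ e : Cohomology k (Plactic A) →ₗ[k] k,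
      e.comp (exteriorToCohomology k).toLinearMap = b.ExteriorAlgebra.coord s := by
    let s' : Set.powersetCard A s.card := ⟨s, rfl⟩
    -- The columns of the elements of `s`, in increasing order.
    let c := column ∘ Set.powersetCard.ofFinEmbEquiv.symm s'
    have hc (i j) : Commute (c i) (c j) := commute_column _ _
    refine ⟨(antisymmEvalH k c hc).comp
      (DirectSum.component k ℕ (H k (Plactic A)) s.card), b.ExteriorAlgebra.ext fun t => ?_⟩
    by_cases h : t.card = s.card
    · rw [ExteriorAlgebra.basis_apply_ofCard b h]
      -- In degree `s.card` the coordinate agrees on basis elements with `exteriorPower.ιMultiDual`,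
      -- whose values on wedge products are determinants.
      have hb : b.ExteriorAlgebra.coord s (ExteriorAlgebra.ιMulti_family k s.card b
          (Set.powersetCard.ofCard h)) = exteriorPower.ιMultiDual k s.card b s'
            (exteriorPower.ιMulti_family k s.card b (Set.powersetCard.ofCard h)) := by
        rw [← ExteriorAlgebra.basis_apply_ofCard b h, Module.Basis.coord_apply,
          Module.Basis.repr_self]
        by_cases hst : s = t
        · subst hst
          rw [Finsupp.single_eq_same]
          exact (exteriorPower.ιMultiDual_apply_diag k _ b s').symm
        · rw [Finsupp.single_eq_of_ne hst, exteriorPower.ιMultiDual_apply_nondiag]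
          exact fun h' => hst (congrArg Subtype.val h')
      rw [hb, exteriorPower.ιMulti_family, exteriorPower.ιMultiDual_apply_ιMulti]
      change antisymmEvalH k c hc (DirectSum.component k ℕ (H k (Plactic A)) s.card
        (exteriorToCohomology k (ExteriorAlgebra.ιMulti k _ _))) = _
      rw [exteriorToCohomology_ιMulti, toCohomology, LinearMap.comp_apply,
        DirectSum.component.lof_self, antisymmEvalH_cls, antisymmEval_cupTuple]
      congr 1
      ext i j
      exact (columnBasis_repr k _ _).symm
    -- For another cardinality both sides vanish: the image lies in a different degree.
    · rw [Module.Basis.coord_apply, Module.Basis.repr_self,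
        Finsupp.single_eq_of_ne (fun hst => h (congrArg _ hst.symm)),
        ExteriorAlgebra.basis_apply_ofCard b rfl]
      change antisymmEvalH k c hc (DirectSum.component k ℕ (H k (Plactic A)) s.card
        (exteriorToCohomology k (ExteriorAlgebra.ιMulti k _ _))) = 0
      rw [exteriorToCohomology_ιMulti, toCohomology, LinearMap.comp_apply,
        DirectSum.component.of, dif_neg h, map_zero]
  rw [injective_iff_map_eq_zero]
  intro x hx
  refine b.ExteriorAlgebra.ext_elem fun s => ?_
  obtain ⟨e, he⟩ := key s
  have := LinearMap.congr_fun he x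
  simpa [hx] using this.symm

end Plactic

theorem theoremT {A : Type*} [LinearOrder A] [Finite A] (k : Type*) [CommRing k] :
    ∃ φ : ExteriorAlgebra k (A →₀ k) →ₐ[k] MonoidHochschild.Cohomology k (Plactic A),
      (∀ a : A, φ (ExteriorAlgebra.ι k (Finsupp.single a 1))
        = MonoidHochschild.toCohomology k (Plactic A) (Plactic.zeta k a)) ∧
      Function.Injective φ := by
  cases nonempty_fintype A
  exact ⟨Plactic.exteriorToCohomology k, fun a => by
    rw [Plactic.exteriorToCohomology_ι, Plactic.linearZeta_single],
    Plactic.exteriorToCohomology_injective k⟩
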